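/- (Dufresne's identity.) Let $B=(B_s)_{s\ge 0}$ be a standard real Brownian motion and let $b>0$ be a real number. Let $\gamma_b$ be a gamma random variable with index $b$, i.e. with density $x\mapsto \Gamma(b)^{-1}x^{b-1}e^{-x}$ on $(0,\infty)$. Then almost surely $$\int_0^\infty \exp\{-2(B_s+bs)\}\,ds<\infty ,$$ and this random variable has the same law as $\dfrac{1}{2\gamma_b}$: $$\int_0^\infty \exp\{-2(B_s+bs)\}\,ds \;\stackrel{\mathcal L}{=}\; \frac{1}{2\gamma_b}.$$ -/

import Mathlib

open MeasureTheory ProbabilityTheory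
open scoped NNReal

/-! Write ψ(y) = E exp(-y/(2γ)), Y_t = l exp(-2(B_t + bt)) and A_t for the functional up to time t,
so that the integral of Y over [0, t] is l A_t. The generator of Y is 2y²∂² + (2-2b)y∂, and
integrating the derivative of y x^(b-1) exp(-x - y/(2x)) over (0, ∞) shows that it maps ψ to yψ
(`invGammaLaplace_ode`). Hence ψ(Y_t) exp(-l A_t) should be a martingale started at ψ(l).

Stochastic calculus is replaced by a grid of mesh h. A Taylor expansion in log y, uniform in y,
shows that one step moves the expectation by O(h^(3/2)) (`exists_abs_step_invGammaLaplace_sub_le`).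
There are N/h steps up to time N, so the total error is O(√h), and h → 0 gives E[ψ(Y_N) exp(-l A_N)]
= ψ(l). Since b > 0, Y_N tends to 0 in law, so ψ(Y_N) tends to 1 in mean and E exp(-l A_N) → ψ(l).

Taking l = n identifies the moments of the limit of exp(-A_N), a variable in [0, 1], with those of
exp(-1/(2γ)), so the two laws agree. The latter variable is positive, so the limit is almost surely
positive: finiteness of the integral comes out of the identity in law. -/

/-! ### Taylor expansion in the logarithmic variable. -/

/-- Mean value bound: a function vanishing at `0` whose derivative is `O(|y| ^ n)`. -/
lemma abs_le_mul_pow_of_abs_deriv_le {g g' : ℝ → ℝ} {K : ℝ} (hK : 0 ≤ K) (n : ℕ)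
    (hg : ∀ y, HasDerivAt g (g' y) y) (h0 : g 0 = 0) (hb : ∀ y, |g' y| ≤ K * |y| ^ n) (x : ℝ) :
    |g x| ≤ K * |x| ^ (n + 1) := by
  have h := (convex_closedBall (0 : ℝ) |x|).norm_image_sub_le_of_norm_hasDerivWithin_le
    (f := g) (f' := g') (C := K * |x| ^ n) (x := 0) (y := x)
    (fun y _ => (hg y).hasDerivWithinAt)
    (fun y hy => by
      refine (hb y).trans ?_
      have : |y| ≤ |x| := by simpa using hy
      gcongr)
    (by simp) (by simp)
  simpa [h0, pow_succ, mul_assoc] using h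

/-- Second order Taylor expansion at `0` with a bounded third derivative. -/
lemma abs_sub_taylor_two_le {f f₁ f₂ f₃ : ℝ → ℝ} {K : ℝ} (hK : 0 ≤ K)
    (h₁ : ∀ y, HasDerivAt f (f₁ y) y) (h₂ : ∀ y, HasDerivAt f₁ (f₂ y) y)
    (h₃ : ∀ y, HasDerivAt f₂ (f₃ y) y) (hb : ∀ y, |f₃ y| ≤ K) (x : ℝ) :
    |f x - (f 0 + f₁ 0 * x + f₂ 0 * x ^ 2 / 2)| ≤ K * |x| ^ 3 := by
  have e₂ := abs_le_mul_pow_of_abs_deriv_le (g := fun y => f₂ y - f₂ 0) hK 0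
    (fun y => (h₃ y).sub_const _) (by simp) (by simpa using hb)
  have e₁ := abs_le_mul_pow_of_abs_deriv_le (g := fun y => f₁ y - (f₁ 0 + f₂ 0 * y)) hK 1
    (fun y => ((h₂ y).sub (((hasDerivAt_id y).const_mul (f₂ 0)).const_add (f₁ 0))))
    (by simp) (by simpa using e₂)
  refine abs_le_mul_pow_of_abs_deriv_le
    (g := fun y => f y - (f 0 + f₁ 0 * y + f₂ 0 * y ^ 2 / 2)) hK 2 (fun y => ?_) (by simp) e₁ x
  have := (h₁ y).sub ((((hasDerivAt_id y).const_mul (f₁ 0)).const_add (f 0)).add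
    ((((hasDerivAt_id y).pow 2).const_mul (f₂ 0)).div_const 2))
  exact this.congr_deriv (by simp only [id]; ring)

lemma mul_exp_neg_le_one {v : ℝ} : v * Real.exp (-v) ≤ 1 := by
  rw [Real.exp_neg, ← div_eq_mul_inv, div_le_one (Real.exp_pos v)]
  linarith [Real.add_one_le_exp v]

lemma sq_mul_exp_neg_le {v : ℝ} (hv : 0 ≤ v) : v ^ 2 * Real.exp (-v) ≤ 2 := by
  rw [Real.exp_neg, ← div_eq_mul_inv, div_le_iff₀ (Real.exp_pos v)]
  linarith [Real.quadratic_le_exp_of_nonneg hv]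

lemma cube_mul_exp_neg_le {v : ℝ} (hv : 0 ≤ v) : v ^ 3 * Real.exp (-v) ≤ 6 := by
  rw [Real.exp_neg, ← div_eq_mul_inv, div_le_iff₀ (Real.exp_pos v)]
  have := Real.pow_div_factorial_le_exp v hv 3
  norm_num [Nat.factorial] at this
  linarith

/-- Expansion of `δ ↦ exp (-(v * exp δ))`, uniform in `v ≥ 0`. -/
lemma abs_exp_neg_mul_exp_sub_le {v : ℝ} (hv : 0 ≤ v) (δ : ℝ) :
    |Real.exp (-(v * Real.exp δ)) - (Real.exp (-v) + -(v * Real.exp (-v)) * δ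
      + (v ^ 2 - v) * Real.exp (-v) * δ ^ 2 / 2)| ≤ 13 * |δ| ^ 3 := by
  have hu : ∀ y, HasDerivAt (fun y => v * Real.exp y) (v * Real.exp y) y :=
    fun y => (Real.hasDerivAt_exp y).const_mul v
  have he : ∀ y, HasDerivAt (fun y => Real.exp (-(v * Real.exp y)))
      (Real.exp (-(v * Real.exp y)) * -(v * Real.exp y)) y := fun y => (hu y).neg.exp
  have := abs_sub_taylor_two_le (f := fun y => Real.exp (-(v * Real.exp y)))
    (f₁ := fun y => -(v * Real.exp y * Real.exp (-(v * Real.exp y))))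
    (f₂ := fun y => ((v * Real.exp y) ^ 2 - v * Real.exp y) * Real.exp (-(v * Real.exp y)))
    (f₃ := fun y => (-(v * Real.exp y) ^ 3 + 3 * (v * Real.exp y) ^ 2 - v * Real.exp y)
      * Real.exp (-(v * Real.exp y))) (K := 13) (by norm_num)
    (fun y => by convert he y using 1; ring)
    (fun y => ((hu y).mul (he y)).neg.congr_deriv (by ring))
    (fun y => ((((hu y).pow 2).sub (hu y)).mul (he y)).congr_deriv
      (by simp only [Pi.sub_apply, Pi.pow_apply]; ring))
    (fun y => by
      have hw : 0 ≤ v * Real.exp y := by positivity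
      -- The constant is 13 = 6 + 3·2 + 1, from the bounds on w³e^(-w), w²e^(-w) and we^(-w).
      generalize v * Real.exp y = w at hw
      have h1 := mul_exp_neg_le_one (v := w)
      have h2 := sq_mul_exp_neg_le hw
      have h3 := cube_mul_exp_neg_le hw
      have p1 : 0 ≤ w * Real.exp (-w) := by positivity
      have p2 : 0 ≤ w ^ 2 * Real.exp (-w) := by positivity
      have p3 : 0 ≤ w ^ 3 * Real.exp (-w) := by positivity
      rw [abs_le]
      constructor <;> nlinarith) δ
  simpa using this

/-! ### Moment determinacy on the unit interval. -/

/-- A finite measure carried by `[0, 1]` is determined by its moments. -/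
lemma Measure.ext_of_forall_integral_pow_eq {μ ν : Measure ℝ} [IsProbabilityMeasure μ]
    [IsProbabilityMeasure ν] (hμ : ∀ᵐ x ∂μ, x ∈ Set.Icc (0 : ℝ) 1)
    (hν : ∀ᵐ x ∂ν, x ∈ Set.Icc (0 : ℝ) 1) (h : ∀ n : ℕ, ∫ x, x ^ n ∂μ = ∫ x, x ^ n ∂ν) :
    μ = ν := by
  -- On [0, 1] the exponential series can be integrated term by term, so the moments give the
  -- characteristic function as a power series.
  have key : ∀ (ρ : Measure ℝ) [IsProbabilityMeasure ρ], (∀ᵐ x ∂ρ, x ∈ Set.Icc (0 : ℝ) 1) →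
      ∀ t : ℝ, HasSum (fun n : ℕ => (t * Complex.I) ^ n / (n.factorial : ℂ)
        * ((∫ x, x ^ n ∂ρ : ℝ) : ℂ)) (charFun ρ t) := by
    intro ρ _ hρ t
    have hb : ∀ n : ℕ, ∀ᵐ x : ℝ ∂ρ, ‖(t * Complex.I * x) ^ n / (n.factorial : ℂ)‖
        ≤ |t| ^ n / n.factorial := by
      intro n
      filter_upwards [hρ] with x hx
      simp only [norm_div, norm_pow, norm_mul, Complex.norm_real, Complex.norm_I, mul_one,
        Complex.norm_natCast, Real.norm_eq_abs]
      gcongr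
      rw [abs_of_nonneg hx.1]
      exact mul_le_of_le_one_right (abs_nonneg t) hx.2
    have hi : ∀ n : ℕ, Integrable (fun x : ℝ => (t * Complex.I * x) ^ n / (n.factorial : ℂ)) ρ :=
      fun n => Integrable.of_bound
        (Continuous.aestronglyMeasurable (by fun_prop)) _ (hb n)
    have hs := hasSum_integral_of_summable_integral_norm hi
      (Summable.of_nonneg_of_le (fun n => integral_nonneg fun _ => norm_nonneg _)
        (fun n => (integral_mono_ae (hi n).norm (integrable_const _) (hb n)).trans_eq (by simp))
        (Real.summable_pow_div_factorial |t|))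
    have hsum : charFun ρ t
        = ∫ x : ℝ, ∑' n : ℕ, (t * Complex.I * x) ^ n / (n.factorial : ℂ) ∂ρ := by
      rw [charFun_apply_real]
      congr 1; funext x
      rw [Complex.exp_eq_exp_ℂ, NormedSpace.exp_eq_tsum_div]
      simp only [mul_right_comm]
    rw [hsum]
    refine hs.congr_fun fun n => ?_
    rw [← integral_complex_ofReal, ← integral_const_mul]
    congr 1; funext x
    push_cast; ring
  refine Measure.ext_of_charFun (funext fun t => ?_)
  exact (key μ hμ t).unique (by simpa only [h] using key ν hν t)

/-! ### The inverse gamma Laplace transform and its differential equation. -/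

/-- Laplace transform of `1 / (2 γ)` for a gamma variable `γ` of index `b`. -/
noncomputable def invGammaLaplace (b y : ℝ) : ℝ :=
  ∫ x, Real.exp (-(y / (2 * x))) ∂gammaMeasure b 1

lemma ae_pos_gammaMeasure (b : ℝ) : ∀ᵐ x ∂gammaMeasure b 1, 0 < x := by
  rw [gammaMeasure, ae_withDensity_iff (by unfold gammaPDF; fun_prop)]
  have : ∀ᵐ x : ℝ, x ≠ 0 := by simp [ae_iff]
  filter_upwards [this] with x hx h
  by_contra h'
  exact h (gammaPDF_of_neg (lt_of_le_of_ne (not_lt.1 h') hx))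

lemma integrable_gammaMeasure_iff {b : ℝ} (hb : 0 < b) {g : ℝ → ℝ} :
    Integrable g (gammaMeasure b 1) ↔
      IntegrableOn (fun x => x ^ (b - 1) * Real.exp (-x) * g x) (Set.Ioi 0) := by
  have hG : 0 < Real.Gamma b := Real.Gamma_pos_of_pos hb
  rw [gammaMeasure, integrable_withDensity_iff (by unfold gammaPDF; fun_prop)
    (by simp [gammaPDF]), ← integrableOn_Ici_iff_integrableOn_Ioi,
    ← integrable_indicator_iff measurableSet_Ici,
    ← integrable_const_mul_iff (c := Real.Gamma b) (by simp [hG.ne'])]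
  refine integrable_congr (ae_of_all _ fun x => ?_)
  simp only [gammaPDF, ENNReal.toReal_ofReal (gammaPDFReal_nonneg hb one_pos x)]
  by_cases hx : 0 ≤ x
  · simp [gammaPDFReal, hx]; field_simp
  · simp [gammaPDFReal, hx]

lemma integral_gammaMeasure {b : ℝ} (hb : 0 < b) (g : ℝ → ℝ) :
    ∫ x, g x ∂gammaMeasure b 1 =
      (Real.Gamma b)⁻¹ * ∫ x in Set.Ioi 0, x ^ (b - 1) * Real.exp (-x) * g x := by
  rw [gammaMeasure, integral_withDensity_eq_integral_toReal_smul (by unfold gammaPDF; fun_prop)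
    (by simp [gammaPDF]), ← integral_Ici_eq_integral_Ioi, ← integral_indicator measurableSet_Ici,
    ← integral_const_mul]
  refine integral_congr_ae (ae_of_all _ fun x => ?_)
  simp only [gammaPDF, ENNReal.toReal_ofReal (gammaPDFReal_nonneg hb one_pos x)]
  by_cases hx : 0 ≤ x
  · simp [gammaPDFReal, hx]; ring
  · simp [gammaPDFReal, hx]

lemma integrable_sq_gammaMeasure {b : ℝ} (hb : 0 < b) :
    Integrable (fun x => x ^ 2) (gammaMeasure b 1) := by
  rw [integrable_gammaMeasure_iff hb]
  refine (Real.GammaIntegral_convergent (s := b + 2) (by positivity)).congr_fun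
    (fun x hx => ?_) measurableSet_Ioi
  have : x ^ (b + 2 - 1) = x ^ (b - 1) * x ^ 2 := by
    rw [← Real.rpow_natCast, ← Real.rpow_add hx]; congr 1; push_cast; ring
  simp only [this]; ring

/-- Boundary terms of the density of the inverse gamma law vanish. -/
lemma tendsto_atTop_rpow_mul_exp_sub (b y : ℝ) (hy : 0 ≤ y) :
    Filter.Tendsto (fun x : ℝ => x ^ (b - 1) * Real.exp (-x - y / (2 * x))) Filter.atTop
      (nhds 0) := by
  refine squeeze_zero' ?_ ?_ (tendsto_rpow_mul_exp_neg_mul_atTop_nhds_zero (b - 1) 1 one_pos)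
  · filter_upwards [Filter.eventually_ge_atTop 0] with x hx
    positivity
  · filter_upwards [Filter.eventually_ge_atTop 0] with x hx
    gcongr
    have : 0 ≤ y / (2 * x) := by positivity
    linarith

/-- With u = 1/x the bound is u^(1-b) exp(-yu/2) at infinity. For b ≤ 1 the power of x does not
vanish at 0, so only the factor with y > 0 forces the limit. -/
lemma tendsto_zero_rpow_mul_exp_sub (b y : ℝ) (hy : 0 < y) :
    Filter.Tendsto (fun x : ℝ => x ^ (b - 1) * Real.exp (-x - y / (2 * x)))
      (nhdsWithin 0 (Set.Ioi 0)) (nhds 0) := by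
  have h := (tendsto_rpow_mul_exp_neg_mul_atTop_nhds_zero (1 - b) (y / 2) (by positivity)).comp
    tendsto_inv_nhdsGT_zero
  refine squeeze_zero' ?_ ?_ h
  · filter_upwards [self_mem_nhdsWithin] with x hx
    have : (0 : ℝ) < x := hx
    positivity
  · filter_upwards [self_mem_nhdsWithin] with x hx
    have hx : (0 : ℝ) < x := hx
    simp only [Function.comp]
    have h1 : x⁻¹ ^ (1 - b) = x ^ (b - 1) := by
      rw [Real.inv_rpow hx.le, ← Real.rpow_neg hx.le]; congr 1; ring
    rw [h1]
    gcongr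
    have : y / (2 * x) = y / 2 * x⁻¹ := by field_simp
    rw [this]; linarith

lemma integrable_gammaMeasure_of_le {b : ℝ} (hb : 0 < b) {g : ℝ → ℝ} (hg : Measurable g) {C : ℝ}
    (h : ∀ x, 0 < x → |g x| ≤ C) : Integrable g (gammaMeasure b 1) := by
  have := isProbabilityMeasure_gammaMeasure hb one_pos
  refine Integrable.of_bound hg.aestronglyMeasurable C ?_
  filter_upwards [ae_pos_gammaMeasure b] with x hx using h x hx

lemma integrable_exp_gammaMeasure {b y : ℝ} (hb : 0 < b) (hy : 0 ≤ y) :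
    Integrable (fun x => Real.exp (-(y / (2 * x)))) (gammaMeasure b 1) := by
  refine integrable_gammaMeasure_of_le hb (by fun_prop) (C := 1) fun x hx => ?_
  rw [abs_of_pos (Real.exp_pos _), Real.exp_le_one_iff]
  have : 0 ≤ y / (2 * x) := by positivity
  linarith

lemma integrable_mul_exp_gammaMeasure {b y : ℝ} (hb : 0 < b) (hy : 0 ≤ y) :
    Integrable (fun x => y / (2 * x) * Real.exp (-(y / (2 * x)))) (gammaMeasure b 1) := by
  refine integrable_gammaMeasure_of_le hb (by fun_prop) (C := 1) fun x hx => ?_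
  rw [abs_of_nonneg (by positivity)]
  exact mul_exp_neg_le_one

lemma integrable_sq_mul_exp_gammaMeasure {b y : ℝ} (hb : 0 < b) (hy : 0 ≤ y) :
    Integrable (fun x => (y / (2 * x)) ^ 2 * Real.exp (-(y / (2 * x)))) (gammaMeasure b 1) := by
  refine integrable_gammaMeasure_of_le hb (by fun_prop) (C := 2) fun x hx => ?_
  rw [abs_of_nonneg (by positivity)]
  exact sq_mul_exp_neg_le (by positivity)

/-- The second order differential equation satisfied by `invGammaLaplace`, written with the
scaling derivatives under the integral sign. -/
lemma invGammaLaplace_ode {b y : ℝ} (hb : 0 < b) (hy : 0 < y) :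
    2 * b * (∫ x, y / (2 * x) * Real.exp (-(y / (2 * x))) ∂gammaMeasure b 1)
      + 2 * ((∫ x, (y / (2 * x)) ^ 2 * Real.exp (-(y / (2 * x))) ∂gammaMeasure b 1)
        - ∫ x, y / (2 * x) * Real.exp (-(y / (2 * x))) ∂gammaMeasure b 1)
      = y * invGammaLaplace b y := by
  have i0 := integrable_exp_gammaMeasure hb hy.le
  have i1 := integrable_mul_exp_gammaMeasure hb hy.le
  have i2 := integrable_sq_mul_exp_gammaMeasure hb hy.le
  set g : ℝ → ℝ := fun x => (2 * b - 2) * (y / (2 * x) * Real.exp (-(y / (2 * x))))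
    + 2 * ((y / (2 * x)) ^ 2 * Real.exp (-(y / (2 * x)))) - y * Real.exp (-(y / (2 * x))) with hg
  have ig : Integrable g (gammaMeasure b 1) :=
    ((i1.const_mul _).add (i2.const_mul _)).sub (i0.const_mul _)
  suffices h : ∫ x, g x ∂gammaMeasure b 1 = 0 by
    simp only [hg] at h
    rw [integral_sub (by exact (i1.const_mul _).add (i2.const_mul _)) (i0.const_mul _),
      integral_add (i1.const_mul _) (i2.const_mul _), integral_const_mul, integral_const_mul,
      integral_const_mul] at h
    unfold invGammaLaplace
    linarith
  rw [integral_gammaMeasure hb, mul_eq_zero]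
  right
  -- Primitive of the weighted integrand: with v = y/(2x), its logarithmic derivative times y is
  -- (2b-2)v + 2v² - y.
  set F : ℝ → ℝ := fun x => y * (x ^ (b - 1) * Real.exp (-x - y / (2 * x))) with hF
  have hd : ∀ x ∈ Set.Ioi (0 : ℝ), HasDerivAt F (x ^ (b - 1) * Real.exp (-x) * g x) x := by
    intro x hx
    have hx : (0 : ℝ) < x := hx
    have h1 := Real.hasDerivAt_rpow_const (x := x) (p := b - 1) (Or.inl hx.ne')
    have h2 := ((hasDerivAt_id x).neg.sub
      ((hasDerivAt_const x y).div ((hasDerivAt_id x).const_mul 2) (by simp; positivity))).exp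
    refine ((h1.mul h2).const_mul y).congr_deriv ?_
    have e1 : x ^ (b - 1 - 1) = x ^ (b - 1) / x := by rw [Real.rpow_sub_one hx.ne']
    have e2 : Real.exp (-x - y / (2 * x)) = Real.exp (-x) * Real.exp (-(y / (2 * x))) := by
      rw [← Real.exp_add]; rfl
    simp only [Pi.sub_apply, Pi.neg_apply, Pi.div_apply, id, e1, e2, hg]
    field_simp
    ring
  have hi := (integrable_gammaMeasure_iff hb).1 ig
  -- Division by zero makes the exponential equal to 1 at x = 0, so for b = 1 the value of `F` there
  -- is y instead of its limit 0; hence the update.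
  have h0 : ContinuousWithinAt (Function.update F 0 0) (Set.Ici 0) 0 := by
    rw [← Set.Ioi_insert, continuousWithinAt_insert_self, continuousWithinAt_update_same]
    have := (tendsto_zero_rpow_mul_exp_sub b y hy).const_mul y
    rw [mul_zero] at this
    exact this.mono_left (nhdsWithin_mono _ (by simp))
  have := integral_Ioi_of_hasDerivAt_of_tendsto (m := 0) h0
    (fun x hx => (hd x hx).congr_of_eventuallyEq (by
      filter_upwards [isOpen_ne.mem_nhds (ne_of_gt hx : x ≠ 0)] with z hz
      exact Function.update_of_ne hz _ _)) hi
    (by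
      have := (tendsto_atTop_rpow_mul_exp_sub b y hy.le).const_mul y
      rw [mul_zero] at this
      refine this.congr' ?_
      filter_upwards [Filter.eventually_ne_atTop 0] with z hz
      rw [Function.update_of_ne hz])
  simpa using this

lemma invGammaLaplace_nonneg (b y : ℝ) : 0 ≤ invGammaLaplace b y :=
  integral_nonneg fun _ => (Real.exp_pos _).le

lemma invGammaLaplace_le_one {b y : ℝ} (hb : 0 < b) (hy : 0 ≤ y) : invGammaLaplace b y ≤ 1 := by
  have := isProbabilityMeasure_gammaMeasure hb one_pos
  refine (integral_mono_ae (integrable_exp_gammaMeasure hb hy) (integrable_const 1) ?_).trans_eq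
    (by simp)
  filter_upwards [ae_pos_gammaMeasure b] with x hx
  rw [Real.exp_le_one_iff]
  have : 0 ≤ y / (2 * x) := by positivity
  linarith

lemma measurable_invGammaLaplace (b : ℝ) : Measurable (invGammaLaplace b) := by
  have : SFinite (gammaMeasure b 1) := by unfold gammaMeasure; infer_instance
  have h : Measurable (fun p : ℝ × ℝ => Real.exp (-(p.1 / (2 * p.2)))) := by fun_prop
  exact (h.stronglyMeasurable.integral_prod_right (ν := gammaMeasure b 1)).measurable

lemma tendsto_invGammaLaplace_zero {b : ℝ} (hb : 0 < b) {ι : Type*} {l : Filter ι}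
    [l.IsCountablyGenerated] {u : ι → ℝ} (hu : ∀ i, 0 ≤ u i) (h : Filter.Tendsto u l (nhds 0)) :
    Filter.Tendsto (fun i => invGammaLaplace b (u i)) l (nhds 1) := by
  have := isProbabilityMeasure_gammaMeasure hb one_pos
  have h1 : (1 : ℝ) = ∫ x, (1 : ℝ) ∂gammaMeasure b 1 := by simp
  rw [h1]
  refine tendsto_integral_filter_of_norm_le_const
    (Filter.Eventually.of_forall fun i => Measurable.aestronglyMeasurable (by fun_prop)) ?_ ?_
  · refine ⟨1, Filter.Eventually.of_forall fun i => ?_⟩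
    filter_upwards [ae_pos_gammaMeasure b] with x hx
    rw [Real.norm_of_nonneg (Real.exp_pos _).le, Real.exp_le_one_iff]
    have := hu i
    have : 0 ≤ u i / (2 * x) := by positivity
    linarith
  · refine ae_of_all _ fun x => ?_
    have := ((h.div_const (2 * x)).neg).rexp
    simpa using this

/-- Quadratic decay of `invGammaLaplace`. -/
lemma sq_mul_invGammaLaplace_le {b y : ℝ} (hb : 0 < b) (hy : 0 ≤ y) :
    y ^ 2 * invGammaLaplace b y ≤ 8 * ∫ x, x ^ 2 ∂gammaMeasure b 1 := by
  unfold invGammaLaplace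
  rw [← integral_const_mul, ← integral_const_mul]
  refine integral_mono_ae ((integrable_exp_gammaMeasure hb hy).const_mul _)
    ((integrable_sq_gammaMeasure hb).const_mul _) ?_
  filter_upwards [ae_pos_gammaMeasure b] with x hx
  have h := sq_mul_exp_neg_le (v := y / (2 * x)) (by positivity)
  have e : y ^ 2 = 4 * x ^ 2 * (y / (2 * x)) ^ 2 := by field_simp; ring
  calc y ^ 2 * Real.exp (-(y / (2 * x)))
      = 4 * x ^ 2 * ((y / (2 * x)) ^ 2 * Real.exp (-(y / (2 * x)))) := by
        nth_rewrite 1 [e]; ring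
    _ ≤ 4 * x ^ 2 * 2 := by gcongr
    _ = 8 * x ^ 2 := by ring

/-- The pointwise expansion at v = y/(2x) has a remainder independent of v, so it integrates
directly, with no differentiation under the integral. The integrals play the roles of -yψ' and
y²ψ''. -/
lemma abs_invGammaLaplace_mul_exp_sub_le {b y : ℝ} (hb : 0 < b) (hy : 0 < y) (δ : ℝ) :
    |invGammaLaplace b (y * Real.exp δ) - (invGammaLaplace b y
      - (∫ x, y / (2 * x) * Real.exp (-(y / (2 * x))) ∂gammaMeasure b 1) * δ
      + ((∫ x, (y / (2 * x)) ^ 2 * Real.exp (-(y / (2 * x))) ∂gammaMeasure b 1)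
        - ∫ x, y / (2 * x) * Real.exp (-(y / (2 * x))) ∂gammaMeasure b 1) * δ ^ 2 / 2)|
      ≤ 13 * |δ| ^ 3 := by
  have := isProbabilityMeasure_gammaMeasure hb one_pos
  have i0 := integrable_exp_gammaMeasure hb hy.le
  have i1 := integrable_mul_exp_gammaMeasure hb hy.le
  have i2 := integrable_sq_mul_exp_gammaMeasure hb hy.le
  have iδ := integrable_exp_gammaMeasure (y := y * Real.exp δ) hb (by positivity)
  have it := (i0.sub (i1.mul_const δ)).add (((i2.sub i1).mul_const (δ ^ 2)).div_const 2)
  have e : invGammaLaplace b (y * Real.exp δ) - (invGammaLaplace b y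
      - (∫ x, y / (2 * x) * Real.exp (-(y / (2 * x))) ∂gammaMeasure b 1) * δ
      + ((∫ x, (y / (2 * x)) ^ 2 * Real.exp (-(y / (2 * x))) ∂gammaMeasure b 1)
        - ∫ x, y / (2 * x) * Real.exp (-(y / (2 * x))) ∂gammaMeasure b 1) * δ ^ 2 / 2)
      = ∫ x, (Real.exp (-(y * Real.exp δ / (2 * x))) - ((Real.exp (-(y / (2 * x)))
        - y / (2 * x) * Real.exp (-(y / (2 * x))) * δ)
        + ((y / (2 * x)) ^ 2 * Real.exp (-(y / (2 * x)))
          - y / (2 * x) * Real.exp (-(y / (2 * x)))) * δ ^ 2 / 2)) ∂gammaMeasure b 1 := by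
    rw [integral_sub iδ (by exact it), integral_add (by exact i0.sub (i1.mul_const δ))
      (by exact ((i2.sub i1).mul_const (δ ^ 2)).div_const 2), integral_sub i0 (i1.mul_const δ),
      integral_mul_const, integral_div, integral_mul_const, integral_sub i2 i1]
    rfl
  rw [e]
  refine (Real.norm_eq_abs _).ge.trans ?_
  refine (norm_integral_le_of_norm_le_const (C := 13 * |δ| ^ 3) ?_).trans_eq (by rw [probReal_univ, mul_one])
  filter_upwards [ae_pos_gammaMeasure b] with x hx
  have := abs_exp_neg_mul_exp_sub_le (v := y / (2 * x)) (by positivity) δ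
  rw [Real.norm_eq_abs]
  convert this using 2
  rw [show y * Real.exp δ / (2 * x) = y / (2 * x) * Real.exp δ by ring]
  ring

/-! ### The one-step estimate. -/

lemma abs_exp_neg_mul_one_add_sub_one_le {u : ℝ} (hu : 0 ≤ u) :
    |Real.exp (-u) * (1 + u) - 1| ≤ u ^ 2 := by
  have h1 := Real.add_one_le_exp (-u)
  have h2 := Real.add_one_le_exp u
  have h3 : Real.exp (-u) * Real.exp u = 1 := by rw [← Real.exp_add]; simp
  have h4 := Real.exp_pos (-u)
  rw [abs_le]
  constructor <;> nlinarith

/-- One step of length `c ^ 2` of the discretised exponential functional almost preserves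
`invGammaLaplace`, uniformly in the starting point. -/
lemma exists_abs_step_invGammaLaplace_sub_le {b : ℝ} (hb : 0 < b) :
    ∃ C : ℝ, 0 ≤ C ∧ ∀ c : ℝ, 0 ≤ c → c ≤ 1 → ∀ y : ℝ, 0 < y →
      |Real.exp (-(c ^ 2 * y)) * (∫ z, invGammaLaplace b (y * Real.exp (-2 * (c * z + b * c ^ 2)))
        ∂gaussianReal 0 1) - invGammaLaplace b y| ≤ C * c ^ 3 := by
  set N := gaussianReal 0 1
  set M : ℝ := ∫ z, 8 * (|z| + b) ^ 3 ∂N with hM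
  set E : ℝ := ∫ x, x ^ 2 ∂gammaMeasure b 1 with hE
  have hM0 : 0 ≤ M := integral_nonneg fun _ => by positivity
  have hE0 : 0 ≤ E := integral_nonneg fun _ => by positivity
  have hz1 : ∫ z, z ∂N = 0 := integral_id_gaussianReal
  have hz2 : ∫ z, z ^ 2 ∂N = 1 := by
    have := variance_fun_id_gaussianReal (μ := 0) (v := 1)
    rw [variance_eq_integral (by fun_prop)] at this
    simpa [hz1, N] using this
  have i1 : Integrable (fun z => z) N := (memLp_id_gaussianReal 1).integrable le_rfl
  have i2 : Integrable (fun z => z ^ 2) N := (memLp_id_gaussianReal 2).integrable_sq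
  have i3 : Integrable (fun z => 8 * (|z| + b) ^ 3) N := by
    have : MemLp (fun z : ℝ => |z| + b) (3 : ℕ) N :=
      (memLp_id_gaussianReal 3).abs.add (memLp_const b)
    have := (this.integrable_norm_pow (by norm_num)).const_mul 8
    refine this.congr (ae_of_all _ fun z => ?_)
    simp only [Real.norm_eq_abs]
    rw [abs_of_nonneg (by positivity : 0 ≤ |z| + b)]
  -- The three terms bound the c⁴ part of the drift, the Taylor remainder (with |δ| ≤ 2c(|z| + b)),
  -- and the second-order error of the killing factor.
  refine ⟨4 * b ^ 2 + 13 * M + 8 * E, by positivity, fun c hc0 hc1 y hy => ?_⟩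
  set p₀ := invGammaLaplace b y with hp₀
  set p₁ := ∫ x, y / (2 * x) * Real.exp (-(y / (2 * x))) ∂gammaMeasure b 1 with hp₁
  set p₂ := ∫ x, (y / (2 * x)) ^ 2 * Real.exp (-(y / (2 * x))) ∂gammaMeasure b 1 with hp₂
  have ode : 2 * b * p₁ + 2 * (p₂ - p₁) = y * p₀ := invGammaLaplace_ode hb hy
  have hG := isProbabilityMeasure_gammaMeasure hb one_pos
  have hp₁0 : 0 ≤ p₁ := integral_nonneg_of_ae (by
    filter_upwards [ae_pos_gammaMeasure b] with x hx
    simp only [Pi.zero_apply]; positivity)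
  have hp₁1 : p₁ ≤ 1 :=
    (integral_mono (integrable_mul_exp_gammaMeasure hb hy.le) (integrable_const 1)
      fun x => mul_exp_neg_le_one).trans_eq (by simp)
  have hp₂0 : 0 ≤ p₂ := integral_nonneg fun x => by positivity
  have hp₂1 : p₂ ≤ 2 :=
    (integral_mono_ae (integrable_sq_mul_exp_gammaMeasure hb hy.le) (integrable_const 2) (by
      filter_upwards [ae_pos_gammaMeasure b] with x hx
      exact sq_mul_exp_neg_le (by positivity))).trans_eq (by simp)
  have hp₀0 : 0 ≤ p₀ := invGammaLaplace_nonneg b y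
  set J := ∫ z, invGammaLaplace b (y * Real.exp (-2 * (c * z + b * c ^ 2))) ∂N with hJ
  have iψ : Integrable (fun z => invGammaLaplace b (y * Real.exp (-2 * (c * z + b * c ^ 2)))) N := by
    refine Integrable.of_bound
      ((measurable_invGammaLaplace b).comp (by fun_prop)).aestronglyMeasurable 1
      (ae_of_all _ fun z => ?_)
    rw [Real.norm_of_nonneg (invGammaLaplace_nonneg _ _)]
    exact invGammaLaplace_le_one hb (by positivity)
  have iq : Integrable (fun z => (p₀ + 2 * b * c ^ 2 * p₁ + 2 * b ^ 2 * c ^ 4 * (p₂ - p₁))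
      + (2 * c * p₁ + 4 * b * c ^ 3 * (p₂ - p₁)) * z + 2 * c ^ 2 * (p₂ - p₁) * z ^ 2) N :=
    ((integrable_const _).add (i1.const_mul _)).add (i2.const_mul _)
  -- The Taylor polynomial at δ = -2(cz + bc²), averaged over z: the differential equation turns its
  -- c² coefficient into y p₀.
  have hq : ∫ z, ((p₀ + 2 * b * c ^ 2 * p₁ + 2 * b ^ 2 * c ^ 4 * (p₂ - p₁))
      + (2 * c * p₁ + 4 * b * c ^ 3 * (p₂ - p₁)) * z + 2 * c ^ 2 * (p₂ - p₁) * z ^ 2) ∂N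
      = p₀ * (1 + c ^ 2 * y) + 2 * b ^ 2 * c ^ 4 * (p₂ - p₁) := by
    rw [integral_add (by exact (integrable_const _).add (i1.const_mul _)) (i2.const_mul _),
      integral_add (integrable_const _) (i1.const_mul _), integral_const_mul, integral_const_mul,
      hz1, hz2]
    simp only [integral_const, probReal_univ, smul_eq_mul]
    linear_combination c ^ 2 * ode
  have hT : |J - (p₀ * (1 + c ^ 2 * y) + 2 * b ^ 2 * c ^ 4 * (p₂ - p₁))| ≤ 13 * c ^ 3 * M := by
    rw [← hq, hJ, ← integral_sub iψ iq, hM, ← integral_const_mul (13 * c ^ 3)]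
    refine (Real.norm_eq_abs _).ge.trans ?_
    refine norm_integral_le_of_norm_le (i3.const_mul (13 * c ^ 3)) (ae_of_all N fun z => ?_)
    have h := abs_invGammaLaplace_mul_exp_sub_le hb hy (-2 * (c * z + b * c ^ 2))
    rw [Real.norm_eq_abs]
    have hδ : |-2 * (c * z + b * c ^ 2)| ≤ c * (2 * (|z| + b)) := by
      rw [abs_mul, abs_neg, abs_two]
      have h1 : |c * z + b * c ^ 2| ≤ c * |z| + b * c ^ 2 := by
        refine (abs_add_le _ _).trans_eq ?_
        rw [abs_mul, abs_of_nonneg hc0, abs_of_nonneg (by positivity : 0 ≤ b * c ^ 2)]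
      have h2 : b * c ^ 2 ≤ b * c := by
        gcongr; nlinarith
      nlinarith
    calc _ = _ := by rw [← hp₀, ← hp₁, ← hp₂]; congr 1; ring
      _ ≤ _ := h
      _ ≤ 13 * (c * (2 * (|z| + b))) ^ 3 := by gcongr
      _ = _ := by ring
  have hc4 : c ^ 4 ≤ c ^ 3 := pow_le_pow_of_le_one hc0 hc1 (by norm_num)
  have hu := abs_exp_neg_mul_one_add_sub_one_le (u := c ^ 2 * y) (by positivity)
  have hd : y ^ 2 * p₀ ≤ 8 * E := sq_mul_invGammaLaplace_le hb hy.le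
  have he1 : Real.exp (-(c ^ 2 * y)) ≤ 1 := by
    rw [Real.exp_le_one_iff]; have : 0 ≤ c ^ 2 * y := by positivity
    linarith
  have hr : |2 * b ^ 2 * c ^ 4 * (p₂ - p₁)| ≤ 4 * b ^ 2 * c ^ 4 := by
    rw [abs_mul, abs_of_nonneg (by positivity : 0 ≤ 2 * b ^ 2 * c ^ 4)]
    have : |p₂ - p₁| ≤ 2 := by rw [abs_le]; constructor <;> linarith
    calc _ ≤ 2 * b ^ 2 * c ^ 4 * 2 := by gcongr
      _ = _ := by ring
  -- The killing factor cancels 1 + c²y up to (c²y)². Multiplied by p₀ this stays bounded uniformly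
  -- in y by the quadratic decay of ψ.
  have e : Real.exp (-(c ^ 2 * y)) * J - p₀
      = Real.exp (-(c ^ 2 * y)) * (J - (p₀ * (1 + c ^ 2 * y) + 2 * b ^ 2 * c ^ 4 * (p₂ - p₁))
        + 2 * b ^ 2 * c ^ 4 * (p₂ - p₁))
        + (Real.exp (-(c ^ 2 * y)) * (1 + c ^ 2 * y) - 1) * p₀ := by ring
  rw [e]
  refine (abs_add_le _ _).trans ?_
  rw [abs_mul, abs_mul, abs_of_pos (Real.exp_pos _), abs_of_nonneg hp₀0]
  calc _ ≤ 1 * (13 * c ^ 3 * M + 4 * b ^ 2 * c ^ 4) + (c ^ 2 * y) ^ 2 * p₀ := by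
        gcongr
        exact (abs_add_le _ _).trans (add_le_add hT hr)
    _ = 13 * c ^ 3 * M + 4 * b ^ 2 * c ^ 4 + c ^ 4 * (y ^ 2 * p₀) := by ring
    _ ≤ 13 * c ^ 3 * M + 4 * b ^ 2 * c ^ 3 + c ^ 3 * (8 * E) := by gcongr
    _ = _ := by ring

/-! ### Riemann sums. -/

/-- Left Riemann sums of a continuous function on `[0, N]` converge to its integral. -/
lemma tendsto_riemannSum_intervalIntegral {f : ℝ → ℝ} (hf : Continuous f) (N : ℕ) :
    Filter.Tendsto (fun m : ℕ => ∑ k ∈ Finset.range (N * (m + 1)),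
      (1 / (m + 1 : ℝ)) * f (k * (1 / (m + 1 : ℝ)))) Filter.atTop
      (nhds (∫ s in (0 : ℝ)..N, f s)) := by
  have huc := (isCompact_Icc (a := (0 : ℝ)) (b := N)).uniformContinuousOn_of_continuous
    hf.continuousOn
  rw [Metric.uniformContinuousOn_iff] at huc
  rw [Metric.tendsto_atTop]
  intro ε hε
  -- Dividing by N + 1 covers N = 0 and makes the final bound εN/(N+1) strict.
  obtain ⟨δ, hδ, h⟩ := huc (ε / (N + 1)) (by positivity)
  obtain ⟨M, hM⟩ := exists_nat_one_div_lt hδ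
  refine ⟨M, fun m hm => ?_⟩
  have hm0 : (0 : ℝ) < 1 / (m + 1 : ℝ) := by positivity
  have hmδ : 1 / (m + 1 : ℝ) < δ := by
    refine lt_of_le_of_lt ?_ hM
    have : (M : ℝ) ≤ m := by exact_mod_cast hm
    gcongr
  set d : ℝ := 1 / (m + 1 : ℝ) with hd
  have hNd : ((N * (m + 1) : ℕ) : ℝ) * d = N := by
    rw [hd]; push_cast; field_simp
  have hsum : ∫ s in (0 : ℝ)..N, f s
      = ∑ k ∈ Finset.range (N * (m + 1)), ∫ s in (k * d)..((k + 1 : ℕ) * d), f s := by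
    rw [intervalIntegral.sum_integral_adjacent_intervals (a := fun k : ℕ => k * d)
      fun k _ => hf.intervalIntegrable _ _]
    rw [hNd]; simp
  rw [hsum, Real.dist_eq, ← Finset.sum_sub_distrib]
  have hterm : ∀ k ∈ Finset.range (N * (m + 1)),
      |d * f (k * d) - ∫ s in (k * d)..((k + 1 : ℕ) * d), f s| ≤ ε / (N + 1) * d := by
    intro k hk
    have hlen : ((k + 1 : ℕ) : ℝ) * d - k * d = d := by push_cast; ring
    have hconst : d * f (k * d) = ∫ s in (k * d)..((k + 1 : ℕ) * d), f (k * d) := by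
      rw [intervalIntegral.integral_const, hlen, smul_eq_mul]
    rw [hconst, ← intervalIntegral.integral_sub (by simp) (hf.intervalIntegrable _ _)]
    have hb := intervalIntegral.norm_integral_le_of_norm_le_const
      (f := fun s => f (k * d) - f s) (a := k * d) (b := (k + 1 : ℕ) * d) (C := ε / (N + 1)) ?_
    · rwa [hlen, abs_of_pos hm0] at hb
    intro s hs
    rw [Set.uIoc_of_le (by linarith)] at hs
    have hk1 : ((k + 1 : ℕ) : ℝ) * d ≤ N := by
      rw [← hNd]
      have : k + 1 ≤ N * (m + 1) := Finset.mem_range.1 hk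
      gcongr
    have hk0 : 0 ≤ k * d := by positivity
    refine (h (k * d) ⟨hk0, by linarith⟩ s ⟨by linarith [hs.1], hs.2.trans hk1⟩ ?_).le
    rw [Real.dist_eq, abs_sub_comm, abs_of_pos (by linarith [hs.1])]
    linarith [hs.2]
  calc _ ≤ ∑ k ∈ Finset.range (N * (m + 1)), ε / (N + 1) * d :=
        (Finset.abs_sum_le_sum_abs _ _).trans (Finset.sum_le_sum hterm)
    _ = ε / (N + 1) * (((N * (m + 1) : ℕ) : ℝ) * d) := by
        rw [Finset.sum_const, Finset.card_range, nsmul_eq_mul]; ring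
    _ = ε * (N / (N + 1)) := by rw [hNd]; ring
    _ < ε * 1 := by
        gcongr
        rw [div_lt_one (by positivity)]; linarith
    _ = ε := mul_one ε

/-! ### The discretised functional along a Brownian path. -/

section PathFunctional

variable {Ω : Type*} [MeasurableSpace Ω] {P : Measure Ω} {B : ℝ≥0 → Ω → ℝ}

/-- The increment of a Brownian motion over `[s, s + t]` is independent of any measurable
functional of the past up to time `s`. -/
lemma IsPreBrownianReal.indepFun_past_increment (hB : IsPreBrownianReal B P) (s t : ℝ≥0)
    {β : Type*} [MeasurableSpace β] {φ : (Set.Iic s → ℝ) → β} (hφ : Measurable φ) :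
    IndepFun (fun ω => φ fun r => B r ω) (fun ω => B (s + t) ω - B s ω) P :=
  ((hB.indepFun_shift s).comp (measurable_pi_apply t) hφ).symm

/-- The value at the grid point `n * h` of the exponential of the drifted Brownian motion,
started from `l`. -/
noncomputable def gridExp (b l : ℝ) (h : ℝ≥0) (x : ℝ≥0 → ℝ) (n : ℕ) : ℝ :=
  l * Real.exp (-2 * (x (n * h) + b * (n * h : ℝ)))

/-- The exponential of minus the Riemann sum of `gridExp`, weighted by `invGammaLaplace`. -/
noncomputable def gridFunctional (b l : ℝ) (h : ℝ≥0) (x : ℝ≥0 → ℝ) (n : ℕ) : ℝ :=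
  invGammaLaplace b (gridExp b l h x n)
    * Real.exp (-∑ k ∈ Finset.range n, (h : ℝ) * gridExp b l h x k)

lemma gridExp_pos {l : ℝ} (hl : 0 < l) (b : ℝ) (h : ℝ≥0) (x : ℝ≥0 → ℝ) (n : ℕ) :
    0 < gridExp b l h x n := by unfold gridExp; positivity

lemma gridFunctional_nonneg (b l : ℝ) (h : ℝ≥0) (x : ℝ≥0 → ℝ) (n : ℕ) :
    0 ≤ gridFunctional b l h x n :=
  mul_nonneg (invGammaLaplace_nonneg _ _) (Real.exp_pos _).le

lemma exp_neg_sum_gridExp_le_one {l : ℝ} (hl : 0 < l) (b : ℝ) (h : ℝ≥0) (x : ℝ≥0 → ℝ) (n : ℕ) :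
    Real.exp (-∑ k ∈ Finset.range n, (h : ℝ) * gridExp b l h x k) ≤ 1 := by
  rw [Real.exp_le_one_iff, neg_nonpos]
  exact Finset.sum_nonneg fun k _ => mul_nonneg h.2 (gridExp_pos hl b h x k).le

lemma gridFunctional_le_one {b l : ℝ} (hb : 0 < b) (hl : 0 < l) (h : ℝ≥0) (x : ℝ≥0 → ℝ) (n : ℕ) :
    gridFunctional b l h x n ≤ 1 :=
  mul_le_one₀ (invGammaLaplace_le_one hb (gridExp_pos hl b h x n).le) (Real.exp_pos _).le
    (exp_neg_sum_gridExp_le_one hl b h x n)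

lemma gridExp_succ (b l : ℝ) (h : ℝ≥0) (x : ℝ≥0 → ℝ) (n : ℕ) :
    gridExp b l h x (n + 1)
      = gridExp b l h x n * Real.exp (-2 * ((x (n * h + h) - x (n * h)) + b * h)) := by
  unfold gridExp
  rw [mul_assoc, ← Real.exp_add]
  congr 2
  have : ((n + 1 : ℕ) : ℝ≥0) * h = n * h + h := by push_cast; ring
  rw [this]; push_cast; ring

lemma gridFunctional_succ (b l : ℝ) (h : ℝ≥0) (x : ℝ≥0 → ℝ) (n : ℕ) :
    gridFunctional b l h x (n + 1)
      = Real.exp (-∑ k ∈ Finset.range n, (h : ℝ) * gridExp b l h x k)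
        * (Real.exp (-(h * gridExp b l h x n)) * invGammaLaplace b (gridExp b l h x n
          * Real.exp (-2 * ((x (n * h + h) - x (n * h)) + b * h)))) := by
  rw [gridFunctional, gridExp_succ, Finset.sum_range_succ, neg_add, Real.exp_add]
  ring

lemma aemeasurable_gridExp (hB : IsPreBrownianReal B P) (b l : ℝ) (h : ℝ≥0) (n : ℕ) :
    AEMeasurable (fun ω => gridExp b l h (B · ω) n) P := by
  unfold gridExp
  have := hB.aemeasurable (n * h)
  fun_prop

lemma aemeasurable_gridFunctional (hB : IsPreBrownianReal B P) (b l : ℝ) (h : ℝ≥0) (n : ℕ) :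
    AEMeasurable (fun ω => gridFunctional b l h (B · ω) n) P := by
  unfold gridFunctional
  refine ((measurable_invGammaLaplace b).comp_aemeasurable
    (aemeasurable_gridExp hB b l h n)).mul (AEMeasurable.exp (AEMeasurable.neg ?_))
  exact Finset.aemeasurable_fun_sum _ fun k _ => (aemeasurable_gridExp hB b l h k).const_mul _

lemma gaussianReal_zero_eq_map_sqrt (h : ℝ≥0) :
    gaussianReal 0 h = (gaussianReal 0 1).map (fun z => √(h : ℝ) * z) := by
  rw [gaussianReal_map_const_mul, mul_zero]
  congr 1
  ext
  simp

/-- The expectation of `gridFunctional` moves by `O(h ^ (3 / 2))` in one step. -/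
lemma exists_abs_integral_gridFunctional_succ_sub_le {b : ℝ} (hb : 0 < b) :
    ∃ C : ℝ, 0 ≤ C ∧ ∀ {Ω : Type*} [MeasurableSpace Ω] {P : Measure Ω} {B : ℝ≥0 → Ω → ℝ},
      IsPreBrownianReal B P → ∀ (l : ℝ), 0 < l → ∀ h : ℝ≥0, h ≤ 1 → ∀ n : ℕ,
      |(∫ ω, gridFunctional b l h (B · ω) (n + 1) ∂P) - ∫ ω, gridFunctional b l h (B · ω) n ∂P|
        ≤ C * √(h : ℝ) ^ 3 := by
  obtain ⟨C, hC, hstep⟩ := exists_abs_step_invGammaLaplace_sub_le hb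
  refine ⟨C, hC, fun {Ω _ P B} hB l hl h hh n => ?_⟩
  have hP : IsProbabilityMeasure P := hB.isGaussianProcess.isProbabilityMeasure
  set Y : Ω → ℝ := fun ω => gridExp b l h (B · ω) n with hY
  set e : Ω → ℝ := fun ω =>
    Real.exp (-∑ k ∈ Finset.range n, (h : ℝ) * gridExp b l h (B · ω) k) with he
  set W : Ω → ℝ := fun ω => B (n * h + h) ω - B (n * h) ω with hW
  have mY : AEMeasurable Y P := aemeasurable_gridExp hB b l h n
  have me : AEMeasurable e P := AEMeasurable.exp (AEMeasurable.neg
    (Finset.aemeasurable_fun_sum _ fun k _ => (aemeasurable_gridExp hB b l h k).const_mul _))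
  have hWlaw : HasLaw W (gaussianReal 0 h) P := (hB.shift (n * h)).hasLaw_eval h
  have mW : AEMeasurable W P := hWlaw.aemeasurable
  have hind : IndepFun (fun ω => (Y ω, e ω)) W P := by
    -- Extending the past path by 0 lets `gridExp`, defined on full paths, be read as a functional
    -- of the past; the grid times used are at most nh.
    have hext : ∃ φ : (Set.Iic ((n : ℝ≥0) * h) → ℝ) → (ℝ≥0 → ℝ), Measurable φ ∧
        ∀ x : ℝ≥0 → ℝ, ∀ r ≤ (n : ℝ≥0) * h, φ (fun r => x r) r = x r := by
      refine ⟨fun x r => if hr : r ≤ (n : ℝ≥0) * h then x ⟨r, hr⟩ else 0,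
        measurable_pi_lambda _ fun r => ?_, fun x r hr => by simp [hr]⟩
      by_cases hr : r ≤ (n : ℝ≥0) * h
      · simpa [hr] using measurable_pi_apply _
      · simp [hr]
    obtain ⟨φ, hφ, hφx⟩ := hext
    have mg : ∀ k, Measurable fun x : ℝ≥0 → ℝ => gridExp b l h x k := by
      intro k; unfold gridExp; fun_prop
    have key := IsPreBrownianReal.indepFun_past_increment hB (n * h) h
      (φ := fun x => (gridExp b l h (φ x) n,
        Real.exp (-∑ k ∈ Finset.range n, (h : ℝ) * gridExp b l h (φ x) k)))
      (((mg n).comp hφ).prodMk (Measurable.exp (Measurable.neg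
        (Finset.measurable_fun_sum _ fun k _ => ((mg k).comp hφ).const_mul _))))
    have hgk : ∀ ω, ∀ k ≤ n, gridExp b l h (φ fun r => B r ω) k = gridExp b l h (B · ω) k := by
      intro ω k hk
      unfold gridExp
      rw [hφx (B · ω) (k * h) (by gcongr)]
    convert key using 2 with ω
    rw [Prod.mk.injEq]
    refine ⟨(hgk ω n le_rfl).symm, ?_⟩
    simp only [he]
    congr 2
    exact Finset.sum_congr rfl fun k hk => by rw [hgk ω k (Finset.mem_range.1 hk).le]
  set Φ : (ℝ × ℝ) × ℝ → ℝ := fun p => p.1.2 * (Real.exp (-(h * p.1.1))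
    * invGammaLaplace b (p.1.1 * Real.exp (-2 * (p.2 + b * h)))) with hΦ
  have mΦ : Measurable Φ := by
    have := measurable_invGammaLaplace b
    fun_prop
  have hV : ∀ ω, gridFunctional b l h (B · ω) (n + 1) = Φ ((Y ω, e ω), W ω) := fun ω =>
    gridFunctional_succ b l h (B · ω) n
  have hle : ∀ y a w : ℝ, 0 < y → 0 ≤ a → a ≤ 1 → |Φ ((y, a), w)| ≤ 1 := by
    intro y a w hy ha0 ha1
    have h1 : Real.exp (-(h * y)) ≤ 1 := by
      rw [Real.exp_le_one_iff]
      have : 0 ≤ (h : ℝ) * y := mul_nonneg h.2 hy.le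
      linarith
    have h2 := invGammaLaplace_nonneg b (y * Real.exp (-2 * (w + b * h)))
    have h3 := invGammaLaplace_le_one hb
      (by positivity : 0 ≤ y * Real.exp (-2 * (w + b * h)))
    have h4 := Real.exp_pos (-(h * y))
    simp only [hΦ]
    rw [abs_of_nonneg (by positivity)]
    exact mul_le_one₀ ha1 (by positivity) (mul_le_one₀ h1 h2 h3)
  have hYpos : ∀ ω, 0 < Y ω := fun ω => gridExp_pos hl b h _ n
  have he0 : ∀ ω, 0 ≤ e ω := fun ω => (Real.exp_pos _).le
  have he1 : ∀ ω, e ω ≤ 1 := fun ω => exp_neg_sum_gridExp_le_one hl b h _ n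
  have mYe : AEMeasurable (fun ω => (Y ω, e ω)) P := mY.prodMk me
  have hmap := (indepFun_iff_map_prod_eq_prod_map_map mYe mW).1 hind
  rw [hWlaw.map_eq] at hmap
  have hPm : IsProbabilityMeasure (P.map fun ω => (Y ω, e ω)) :=
    Measure.isProbabilityMeasure_map mYe
  have hae : ∀ᵐ p ∂(P.map fun ω => (Y ω, e ω)).prod (gaussianReal 0 h), ‖Φ p‖ ≤ 1 := by
    rw [← hmap, ae_map_iff (mYe.prodMk mW) (measurableSet_le (by fun_prop) (by fun_prop))]
    exact ae_of_all _ fun ω => hle _ _ _ (hYpos ω) (he0 ω) (he1 ω)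
  -- Independence and Fubini integrate out the increment, which is √h times a standard normal
  -- variable; this is the one-step estimate with c = √h.
  have hint : ∫ ω, gridFunctional b l h (B · ω) (n + 1) ∂P
      = ∫ ω, e ω * (Real.exp (-(h * Y ω)) * ∫ z, invGammaLaplace b
        (Y ω * Real.exp (-2 * (√(h : ℝ) * z + b * h))) ∂gaussianReal 0 1) ∂P := by
    simp_rw [hV]
    rw [← integral_map (f := Φ) (mYe.prodMk mW) mΦ.aestronglyMeasurable, hmap,
      integral_prod _ (Integrable.of_bound mΦ.aestronglyMeasurable 1 hae),
      integral_map mYe (mΦ.stronglyMeasurable.integral_prod_right').aestronglyMeasurable]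
    refine integral_congr_ae (ae_of_all _ fun ω => ?_)
    have mh : Measurable fun w => invGammaLaplace b (Y ω * Real.exp (-2 * (w + b * h))) :=
      (measurable_invGammaLaplace b).comp (by fun_prop)
    simp only [hΦ]
    rw [integral_const_mul, integral_const_mul, gaussianReal_zero_eq_map_sqrt,
      integral_map (by fun_prop) mh.aestronglyMeasurable]
  have hbound : ∀ ω, |gridFunctional b l h (B · ω) n| ≤ 1 := fun ω => by
    rw [abs_of_nonneg (gridFunctional_nonneg ..)]; exact gridFunctional_le_one hb hl ..
  have iV : Integrable (fun ω => gridFunctional b l h (B · ω) n) P :=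
    Integrable.of_bound (aemeasurable_gridFunctional hB b l h n).aestronglyMeasurable 1
      (ae_of_all _ hbound)
  have hsq : √(h : ℝ) ^ 2 = h := Real.sq_sqrt h.2
  have hs1 : √(h : ℝ) ≤ 1 := Real.sqrt_le_one.2 (by exact_mod_cast hh)
  have hpt : ∀ ω, |e ω * (Real.exp (-(h * Y ω)) * ∫ z, invGammaLaplace b
        (Y ω * Real.exp (-2 * (√(h : ℝ) * z + b * h))) ∂gaussianReal 0 1)
        - gridFunctional b l h (B · ω) n| ≤ C * √(h : ℝ) ^ 3 := by
    intro ω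
    have := hstep (√(h : ℝ)) (Real.sqrt_nonneg _) hs1 (Y ω) (hYpos ω)
    rw [hsq] at this
    have e1 : gridFunctional b l h (B · ω) n = e ω * invGammaLaplace b (Y ω) := mul_comm _ _
    rw [e1, ← mul_sub, abs_mul, abs_of_nonneg (he0 ω)]
    calc _ ≤ 1 * (C * √(h : ℝ) ^ 3) := by gcongr; exact he1 ω
      _ = _ := one_mul _
  have mJ : Measurable fun y : ℝ => ∫ z, invGammaLaplace b
        (y * Real.exp (-2 * (√(h : ℝ) * z + b * h))) ∂gaussianReal 0 1 := by
    have : Measurable fun p : ℝ × ℝ => invGammaLaplace b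
        (p.1 * Real.exp (-2 * (√(h : ℝ) * p.2 + b * h))) :=
      (measurable_invGammaLaplace b).comp (by fun_prop)
    exact this.stronglyMeasurable.integral_prod_right'.measurable
  have iE : Integrable (fun ω => e ω * (Real.exp (-(h * Y ω)) * ∫ z, invGammaLaplace b
        (Y ω * Real.exp (-2 * (√(h : ℝ) * z + b * h))) ∂gaussianReal 0 1)) P := by
    refine Integrable.of_bound (me.mul (AEMeasurable.mul (by fun_prop)
      (mJ.comp_aemeasurable mY))).aestronglyMeasurable (C * √(h : ℝ) ^ 3 + 1)
      (ae_of_all _ fun ω => ?_)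
    have h1 := hpt ω
    have h2 := hbound ω
    rw [Real.norm_eq_abs]
    rw [abs_le] at *
    constructor <;> linarith
  rw [hint, ← integral_sub iE iV]
  refine (Real.norm_eq_abs _).ge.trans ?_
  refine (norm_integral_le_of_norm_le_const (ae_of_all _ hpt)).trans_eq ?_
  rw [probReal_univ, mul_one]

/-! ### From the grid to continuous time. -/

lemma continuous_exp_drift {x : ℝ≥0 → ℝ} (hx : Continuous x) (b : ℝ) :
    Continuous fun s : ℝ => Real.exp (-2 * (x s.toNNReal + b * s)) := by
  have := hx.comp continuous_real_toNNReal
  simp only [Function.comp_def] at this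
  fun_prop

lemma gridExp_eq (b l : ℝ) (h : ℝ≥0) (x : ℝ≥0 → ℝ) (n : ℕ) :
    gridExp b l h x n = l * Real.exp (-2 * (x (n * h : ℝ).toNNReal + b * (n * h : ℝ))) := by
  have : (n * h : ℝ).toNNReal = n * h := by
    rw [← Real.toNNReal_coe (r := n * h)]; push_cast; rfl
  rw [this, gridExp]

/-- Telescoping of the one-step errors; the start is ψ(l) because B vanishes almost surely at time
0. -/
lemma abs_integral_gridFunctional_sub_le {C b l : ℝ} {h : ℝ≥0}
    (hB : IsPreBrownianReal B P)
    (hstep : ∀ n : ℕ, |(∫ ω, gridFunctional b l h (B · ω) (n + 1) ∂P)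
      - ∫ ω, gridFunctional b l h (B · ω) n ∂P| ≤ C * √(h : ℝ) ^ 3) (n : ℕ) :
    |(∫ ω, gridFunctional b l h (B · ω) n ∂P) - invGammaLaplace b l|
      ≤ n * (C * √(h : ℝ) ^ 3) := by
  have hP : IsProbabilityMeasure P := hB.isGaussianProcess.isProbabilityMeasure
  induction n with
  | zero =>
    have : ∫ ω, gridFunctional b l h (B · ω) 0 ∂P = ∫ ω, invGammaLaplace b l ∂P := by
      refine integral_congr_ae ?_
      filter_upwards [hB.eval_zero_ae_eq_zero] with ω hω
      simp [gridFunctional, gridExp, hω]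
    simp [this]
  | succ n ih =>
    have h1 := hstep n
    push_cast
    rw [abs_le] at *
    constructor <;> linarith

/-- The exponential functional up to time `N` is the limit of its Riemann sums. -/
lemma tendsto_sum_gridExp {x : ℝ≥0 → ℝ} (hx : Continuous x) (b l : ℝ) (N : ℕ) :
    Filter.Tendsto (fun m : ℕ => ∑ k ∈ Finset.range (N * (m + 1)),
      (((m + 1 : ℝ≥0)⁻¹ : ℝ≥0) : ℝ) * gridExp b l (m + 1 : ℝ≥0)⁻¹ x k) Filter.atTop
      (nhds (l * ∫ s in (0 : ℝ)..N, Real.exp (-2 * (x s.toNNReal + b * s)))) := by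
  have := (tendsto_riemannSum_intervalIntegral (continuous_exp_drift hx b) N).const_mul l
  refine this.congr fun m => ?_
  rw [Finset.mul_sum]
  refine Finset.sum_congr rfl fun k _ => ?_
  rw [gridExp_eq]
  push_cast
  rw [one_div]
  ring

/-- Paths are continuous only almost surely, so measurability is obtained from the almost sure limit
of Riemann sums. -/
lemma aemeasurable_integral_exp_drift (hB : IsBrownianReal B P) (b : ℝ) (N : ℕ) :
    AEMeasurable (fun ω => ∫ s in (0 : ℝ)..N, Real.exp (-2 * (B s.toNNReal ω + b * s))) P := by
  refine aemeasurable_of_tendsto_metrizable_ae Filter.atTop (f := fun (m : ℕ) ω =>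
    ∑ k ∈ Finset.range (N * (m + 1)),
      (((m + 1 : ℝ≥0)⁻¹ : ℝ≥0) : ℝ) * gridExp b 1 (m + 1 : ℝ≥0)⁻¹ (B · ω) k) (fun m => ?_) ?_
  · exact Finset.aemeasurable_fun_sum _ fun k _ =>
      (aemeasurable_gridExp hB.toIsPreBrownianReal b 1 _ k).const_mul _
  · filter_upwards [hB.cont] with ω hω
    simpa using tendsto_sum_gridExp hω b 1 N

/-- Constancy of the expectation of the martingale `ψ (l Y_N) exp (-l A_N)`. -/
lemma integral_invGammaLaplace_mul_exp (hB : IsBrownianReal B P) {b l : ℝ} (hb : 0 < b)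
    (hl : 0 < l) (N : ℕ) :
    ∫ ω, invGammaLaplace b (l * Real.exp (-2 * (B N ω + b * N)))
      * Real.exp (-(l * ∫ s in (0 : ℝ)..N, Real.exp (-2 * (B s.toNNReal ω + b * s)))) ∂P
      = invGammaLaplace b l := by
  have hB' := hB.toIsPreBrownianReal
  have hP : IsProbabilityMeasure P := hB'.isGaussianProcess.isProbabilityMeasure
  obtain ⟨C, hC, hstep⟩ := exists_abs_integral_gridFunctional_succ_sub_le hb
  have hend : ∀ (m : ℕ) (x : ℝ≥0 → ℝ), gridExp b l (m + 1 : ℝ≥0)⁻¹ x (N * (m + 1))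
      = l * Real.exp (-2 * (x N + b * N)) := by
    intro m x
    have e1 : ((N * (m + 1) : ℕ) : ℝ≥0) * (m + 1 : ℝ≥0)⁻¹ = N := by
      push_cast; field_simp
    have e2 : ((N * (m + 1) : ℕ) : ℝ) * (((m + 1 : ℝ≥0)⁻¹ : ℝ≥0) : ℝ) = N := by
      exact_mod_cast congrArg NNReal.toReal e1
    rw [gridExp, e1, e2]
  have h1 : Filter.Tendsto (fun m : ℕ => ∫ ω, gridFunctional b l (m + 1 : ℝ≥0)⁻¹ (B · ω)
      (N * (m + 1)) ∂P) Filter.atTop (nhds (∫ ω, invGammaLaplace b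
        (l * Real.exp (-2 * (B N ω + b * N))) * Real.exp (-(l * ∫ s in (0 : ℝ)..N,
          Real.exp (-2 * (B s.toNNReal ω + b * s)))) ∂P)) := by
    refine tendsto_integral_filter_of_norm_le_const (Filter.Eventually.of_forall fun m =>
      (aemeasurable_gridFunctional hB' b l _ _).aestronglyMeasurable)
      ⟨1, Filter.Eventually.of_forall fun m => ae_of_all _ fun ω => ?_⟩ ?_
    · rw [Real.norm_of_nonneg (gridFunctional_nonneg ..)]
      exact gridFunctional_le_one hb hl ..
    · filter_upwards [hB.cont] with ω hω
      simp only [gridFunctional, hend]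
      exact ((tendsto_sum_gridExp hω b l N).neg.rexp).const_mul _
  have h2 : Filter.Tendsto (fun m : ℕ => ∫ ω, gridFunctional b l (m + 1 : ℝ≥0)⁻¹ (B · ω)
      (N * (m + 1)) ∂P) Filter.atTop (nhds (invGammaLaplace b l)) := by
    rw [tendsto_iff_norm_sub_tendsto_zero]
    -- With h = 1/(m+1), the N(m+1) errors C h^(3/2) add up to N C √h.
    have hz : Filter.Tendsto (fun m : ℕ => N * C * √(1 / ((m : ℝ) + 1))) Filter.atTop
        (nhds 0) := by
      have := (tendsto_one_div_add_atTop_nhds_zero_nat (𝕜 := ℝ)).sqrt.const_mul (N * C)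
      simpa using this
    refine squeeze_zero (fun _ => norm_nonneg _) (fun m => ?_) hz
    have hm : (m + 1 : ℝ≥0)⁻¹ ≤ 1 := inv_le_one_of_one_le₀ (by simp)
    refine (abs_integral_gridFunctional_sub_le hB' (hstep hB' l hl _ hm) _).trans_eq ?_
    have e : (((m + 1 : ℝ≥0)⁻¹ : ℝ≥0) : ℝ) = 1 / ((m : ℝ) + 1) := by push_cast; rw [one_div]
    rw [e, pow_succ, Real.sq_sqrt (by positivity)]
    push_cast
    field_simp
  exact tendsto_nhds_unique h1 h2

/-! ### The limit of large time. -/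

/-- Only the law at time N matters. Replacing B_N by √N z, the exponent -2√N(z + b√N) tends to -∞
for each fixed z, so bounded convergence applies without path asymptotics. -/
lemma tendsto_integral_invGammaLaplace_endpoint (hB : IsPreBrownianReal B P) {b l : ℝ}
    (hb : 0 < b) (hl : 0 < l) :
    Filter.Tendsto (fun N : ℕ => ∫ ω, invGammaLaplace b (l * Real.exp (-2 * (B N ω + b * N))) ∂P)
      Filter.atTop (nhds 1) := by
  have mψ : ∀ N : ℕ, Measurable fun w : ℝ =>
      invGammaLaplace b (l * Real.exp (-2 * (w + b * N))) := fun N =>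
    (measurable_invGammaLaplace b).comp (by fun_prop)
  have e : ∀ N : ℕ, ∫ ω, invGammaLaplace b (l * Real.exp (-2 * (B N ω + b * N))) ∂P
      = ∫ z, invGammaLaplace b (l * Real.exp (-2 * (√(N : ℝ) * z + b * N)))
        ∂gaussianReal 0 1 := by
    intro N
    have h1 := (hB.hasLaw_eval N)
    rw [← integral_map (f := fun w => invGammaLaplace b (l * Real.exp (-2 * (w + b * N))))
      h1.aemeasurable (mψ N).aestronglyMeasurable, h1.map_eq, gaussianReal_zero_eq_map_sqrt,
      integral_map (by fun_prop) (mψ N).aestronglyMeasurable]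
    simp
  simp_rw [e]
  have h1 : (1 : ℝ) = ∫ z, (1 : ℝ) ∂gaussianReal 0 1 := by simp
  rw [h1]
  refine tendsto_integral_filter_of_norm_le_const (Filter.Eventually.of_forall fun N =>
    ((mψ N).comp (by fun_prop)).aestronglyMeasurable)
    ⟨1, Filter.Eventually.of_forall fun N => ae_of_all _ fun z => ?_⟩ (ae_of_all _ fun z => ?_)
  · rw [Real.norm_of_nonneg (invGammaLaplace_nonneg _ _)]
    exact invGammaLaplace_le_one hb (by positivity)
  · refine tendsto_invGammaLaplace_zero hb (fun N => by positivity) ?_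
    have hs : Filter.Tendsto (fun N : ℕ => √(N : ℝ)) Filter.atTop Filter.atTop :=
      Real.tendsto_sqrt_atTop.comp tendsto_natCast_atTop_atTop
    have h2 : Filter.Tendsto (fun N : ℕ => √(N : ℝ) * (z + b * √(N : ℝ))) Filter.atTop
        Filter.atTop :=
      hs.atTop_mul_atTop₀ (Filter.tendsto_atTop_add_const_left _ _ (hs.const_mul_atTop hb))
    have h3 := ((Real.tendsto_exp_atBot.comp
      (h2.const_mul_atTop_of_neg (by norm_num : (-2 : ℝ) < 0))).const_mul l)
    rw [mul_zero] at h3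
    refine h3.congr fun N => ?_
    simp only [Function.comp]
    congr 3
    have := Real.mul_self_sqrt (Nat.cast_nonneg (α := ℝ) N)
    linear_combination b * this

/-- Removing the factor ψ(Y_N) from the martingale identity costs at most E[1 - ψ(Y_N)], since
exp(-l A_N) ≤ 1. -/
lemma tendsto_integral_exp_neg_mul (hB : IsBrownianReal B P) {b l : ℝ} (hb : 0 < b)
    (hl : 0 < l) :
    Filter.Tendsto (fun N : ℕ => ∫ ω, Real.exp (-(l * ∫ s in (0 : ℝ)..N,
      Real.exp (-2 * (B s.toNNReal ω + b * s)))) ∂P) Filter.atTop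
      (nhds (invGammaLaplace b l)) := by
  have hB' := hB.toIsPreBrownianReal
  have hP : IsProbabilityMeasure P := hB'.isGaussianProcess.isProbabilityMeasure
  rw [tendsto_iff_norm_sub_tendsto_zero]
  have h1 := (tendsto_integral_invGammaLaplace_endpoint hB' hb hl).const_sub 1
  rw [sub_self] at h1
  refine squeeze_zero (fun _ => norm_nonneg _) (fun N => ?_) h1
  have hE1 : ∀ ω, Real.exp (-(l * ∫ s in (0 : ℝ)..N,
      Real.exp (-2 * (B s.toNNReal ω + b * s)))) ≤ 1 := fun ω => by
    rw [Real.exp_le_one_iff, neg_nonpos]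
    exact mul_nonneg hl.le (intervalIntegral.integral_nonneg (Nat.cast_nonneg N)
      fun _ _ => (Real.exp_pos _).le)
  have mE : AEMeasurable (fun ω => Real.exp (-(l * ∫ s in (0 : ℝ)..N,
      Real.exp (-2 * (B s.toNNReal ω + b * s))))) P :=
    ((aemeasurable_integral_exp_drift hB b N).const_mul l).neg.exp
  have mψ : AEMeasurable (fun ω => invGammaLaplace b (l * Real.exp (-2 * (B N ω + b * N)))) P := by
    have := hB'.aemeasurable N
    exact (measurable_invGammaLaplace b).comp_aemeasurable (by fun_prop)
  have hψ0 : ∀ ω, 0 ≤ invGammaLaplace b (l * Real.exp (-2 * (B N ω + b * N))) :=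
    fun ω => invGammaLaplace_nonneg _ _
  have hψ1 : ∀ ω, invGammaLaplace b (l * Real.exp (-2 * (B N ω + b * N))) ≤ 1 :=
    fun ω => invGammaLaplace_le_one hb (by positivity)
  have iE : Integrable _ P := Integrable.of_bound mE.aestronglyMeasurable 1
    (ae_of_all _ fun ω => by rw [Real.norm_of_nonneg (Real.exp_pos _).le]; exact hE1 ω)
  have iψ : Integrable _ P := Integrable.of_bound mψ.aestronglyMeasurable 1
    (ae_of_all _ fun ω => by rw [Real.norm_of_nonneg (hψ0 ω)]; exact hψ1 ω)
  have iψE : Integrable (fun ω => invGammaLaplace b (l * Real.exp (-2 * (B N ω + b * N)))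
      * Real.exp (-(l * ∫ s in (0 : ℝ)..N, Real.exp (-2 * (B s.toNNReal ω + b * s))))) P :=
    Integrable.of_bound (mψ.mul mE).aestronglyMeasurable 1
    (ae_of_all _ fun ω => by
      rw [Real.norm_of_nonneg (mul_nonneg (hψ0 ω) (Real.exp_pos _).le)]
      exact mul_le_one₀ (hψ1 ω) (Real.exp_pos _).le (hE1 ω))
  have hsub : 1 - ∫ ω, invGammaLaplace b (l * Real.exp (-2 * (B N ω + b * N))) ∂P
      = ∫ ω, (1 - invGammaLaplace b (l * Real.exp (-2 * (B N ω + b * N)))) ∂P := by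
    rw [integral_sub (integrable_const 1) iψ]; simp
  rw [← integral_invGammaLaplace_mul_exp hB hb hl N, ← integral_sub iE iψE, hsub]
  refine norm_integral_le_of_norm_le ((integrable_const 1).sub iψ) (ae_of_all _ fun ω => ?_)
  have a1 := hE1 ω
  have a2 := hψ1 ω
  rw [← one_sub_mul, Real.norm_of_nonneg (mul_nonneg (by linarith) (Real.exp_pos _).le)]
  exact mul_le_of_le_one_right (by linarith) a1

/-! ### The perpetual functional and its law. -/

lemma antitone_exp_neg_integral {x : ℝ≥0 → ℝ} (hx : Continuous x) (b : ℝ) :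
    Antitone fun N : ℕ => Real.exp (-∫ s in (0 : ℝ)..N,
      Real.exp (-2 * (x s.toNNReal + b * s))) := by
  refine antitone_nat_of_succ_le fun N => ?_
  have hi := fun u v => (continuous_exp_drift hx b).intervalIntegrable (μ := volume) u v
  rw [Real.exp_le_exp, neg_le_neg_iff,
    ← intervalIntegral.integral_add_adjacent_intervals (hi 0 N) (hi N (N + 1 : ℕ))]
  have : 0 ≤ ∫ s in (N : ℝ)..(N + 1 : ℕ), Real.exp (-2 * (x s.toNNReal + b * s)) :=
    intervalIntegral.integral_nonneg (by push_cast; linarith) fun _ _ => (Real.exp_pos _).le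
  linarith

lemma bddBelow_exp_range {ι : Type*} (u : ι → ℝ) :
    BddBelow (Set.range fun i => Real.exp (u i)) :=
  ⟨0, by rintro _ ⟨i, rfl⟩; exact (Real.exp_pos _).le⟩

/-- A positive limit of `exp (-A_N)` forces the exponential functional to be finite. -/
lemma integrableOn_exp_drift_of_iInf_pos {x : ℝ≥0 → ℝ} (hx : Continuous x) {b : ℝ}
    (hpos : 0 < ⨅ N : ℕ, Real.exp (-∫ s in (0 : ℝ)..N,
      Real.exp (-2 * (x s.toNNReal + b * s)))) :
    IntegrableOn (fun s : ℝ => Real.exp (-2 * (x s.toNNReal + b * s))) (Set.Ioi 0) ∧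
      ∫ s in Set.Ioi (0 : ℝ), Real.exp (-2 * (x s.toNNReal + b * s))
        = -Real.log (⨅ N : ℕ, Real.exp (-∫ s in (0 : ℝ)..N,
          Real.exp (-2 * (x s.toNNReal + b * s)))) := by
  have hc := continuous_exp_drift hx b
  have hi : IntegrableOn (fun s : ℝ => Real.exp (-2 * (x s.toNNReal + b * s))) (Set.Ioi 0) := by
    refine integrableOn_Ioi_of_intervalIntegral_norm_bounded (l := Filter.atTop)
      (b := fun N : ℕ => (N : ℝ)) (-Real.log (⨅ N : ℕ, Real.exp (-∫ s in (0 : ℝ)..N,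
          Real.exp (-2 * (x s.toNNReal + b * s))))) 0
      (fun N => (hc.intervalIntegrable (μ := volume) 0 N).1) tendsto_natCast_atTop_atTop
      (Filter.Eventually.of_forall fun N => ?_)
    simp only [Real.norm_eq_abs, Real.abs_exp]
    have h1 := Real.log_le_log hpos (ciInf_le (bddBelow_exp_range _) N)
    rw [Real.log_exp] at h1
    linarith
  refine ⟨hi, ?_⟩
  have h1 := (intervalIntegral_tendsto_integral_Ioi 0 hi
    (tendsto_natCast_atTop_atTop (R := ℝ))).neg.rexp
  have h2 := tendsto_atTop_ciInf (antitone_exp_neg_integral hx b) (bddBelow_exp_range _)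
  rw [← tendsto_nhds_unique h1 h2, Real.log_exp, neg_neg]

/-- The law of `exp (-A)` for the exponential functional `A`. -/
lemma map_iInf_exp_neg_integral (hB : IsBrownianReal B P) {b : ℝ} (hb : 0 < b) :
    AEMeasurable (fun ω => ⨅ N : ℕ, Real.exp (-∫ s in (0 : ℝ)..N,
      Real.exp (-2 * (B s.toNNReal ω + b * s)))) P ∧
    P.map (fun ω => ⨅ N : ℕ, Real.exp (-∫ s in (0 : ℝ)..N,
      Real.exp (-2 * (B s.toNNReal ω + b * s))))
      = (gammaMeasure b 1).map fun x => Real.exp (-(1 / (2 * x))) := by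
  have hP : IsProbabilityMeasure P :=
    hB.toIsPreBrownianReal.isGaussianProcess.isProbabilityMeasure
  have hG := isProbabilityMeasure_gammaMeasure hb one_pos
  set L : Ω → ℝ := fun ω => ⨅ N : ℕ, Real.exp (-∫ s in (0 : ℝ)..N,
    Real.exp (-2 * (B s.toNNReal ω + b * s))) with hL
  have mN : ∀ N : ℕ, AEMeasurable (fun ω => Real.exp (-∫ s in (0 : ℝ)..N,
      Real.exp (-2 * (B s.toNNReal ω + b * s)))) P := fun N =>
    (aemeasurable_integral_exp_drift hB b N).neg.exp
  have mL : AEMeasurable L P := AEMeasurable.iInf mN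
  have hE1 : ∀ ω (N : ℕ), Real.exp (-∫ s in (0 : ℝ)..N,
      Real.exp (-2 * (B s.toNNReal ω + b * s))) ≤ 1 := fun ω N => by
    rw [Real.exp_le_one_iff, neg_nonpos]
    exact intervalIntegral.integral_nonneg (Nat.cast_nonneg N) fun _ _ => (Real.exp_pos _).le
  have hL0 : ∀ ω, 0 ≤ L ω := fun ω => Real.iInf_nonneg fun N => (Real.exp_pos _).le
  have hL1 : ∀ ω, L ω ≤ 1 := fun ω => (ciInf_le (bddBelow_exp_range _) 0).trans (hE1 ω 0)
  have mg : Measurable fun x : ℝ => Real.exp (-(1 / (2 * x))) := by fun_prop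
  refine ⟨mL, ?_⟩
  have := Measure.isProbabilityMeasure_map mL
  have := Measure.isProbabilityMeasure_map (μ := gammaMeasure b 1) mg.aemeasurable
  refine Measure.ext_of_forall_integral_pow_eq ?_ ?_ fun n => ?_
  · rw [ae_map_iff (p := (· ∈ Set.Icc (0 : ℝ) 1)) mL measurableSet_Icc]
    exact ae_of_all _ fun ω => ⟨hL0 ω, hL1 ω⟩
  · rw [ae_map_iff (p := (· ∈ Set.Icc (0 : ℝ) 1)) mg.aemeasurable measurableSet_Icc]
    filter_upwards [ae_pos_gammaMeasure b] with x hx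
    refine ⟨(Real.exp_pos _).le, ?_⟩
    rw [Real.exp_le_one_iff]
    have : 0 ≤ 1 / (2 * x) := by positivity
    linarith
  rw [integral_map mL (by fun_prop), integral_map mg.aemeasurable (by fun_prop)]
  -- The zeroth moment is separate because the Laplace limit needs l = n > 0.
  rcases Nat.eq_zero_or_pos n with rfl | hn
  · simp
  have hψ : ∫ x, Real.exp (-(1 / (2 * x))) ^ n ∂gammaMeasure b 1 = invGammaLaplace b n := by
    unfold invGammaLaplace
    congr 1; funext x
    rw [← Real.exp_nat_mul]
    congr 1; ring
  rw [hψ]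
  refine tendsto_nhds_unique ?_ (tendsto_integral_exp_neg_mul hB hb (Nat.cast_pos.2 hn))
  have hpow : ∀ (N : ℕ) ω, Real.exp (-(n * ∫ s in (0 : ℝ)..N,
      Real.exp (-2 * (B s.toNNReal ω + b * s)))) = Real.exp (-∫ s in (0 : ℝ)..N,
      Real.exp (-2 * (B s.toNNReal ω + b * s))) ^ n := by
    intro N ω
    rw [← Real.exp_nat_mul]; congr 1; ring
  simp_rw [hpow]
  refine tendsto_integral_filter_of_norm_le_const (Filter.Eventually.of_forall fun N =>
    ((mN N).pow_const n).aestronglyMeasurable)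
    ⟨1, Filter.Eventually.of_forall fun N => ae_of_all _ fun ω => ?_⟩ ?_
  · rw [Real.norm_of_nonneg (by positivity)]
    exact pow_le_one₀ (Real.exp_pos _).le (hE1 ω N)
  · filter_upwards [hB.cont] with ω hω
    exact (tendsto_atTop_ciInf (antitone_exp_neg_integral hω b) (bddBelow_exp_range _)).pow n

end PathFunctional

theorem mainTheorem4 {Ω : Type*} [MeasurableSpace Ω] (P : Measure Ω)
    (B : ℝ≥0 → Ω → ℝ) (hB : IsBrownianReal B P) (b : ℝ) (hb : 0 < b)
    {Ω' : Type*} [MeasurableSpace Ω'] (P' : Measure Ω')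
    (γ : Ω' → ℝ) (hγ : HasLaw γ (gammaMeasure b 1) P') :
    (∀ᵐ ω ∂P, IntegrableOn
      (fun s : ℝ => Real.exp (-2 * (B s.toNNReal ω + b * s))) (Set.Ioi 0)) ∧
    IdentDistrib
      (fun ω => ∫ s in Set.Ioi (0 : ℝ), Real.exp (-2 * (B s.toNNReal ω + b * s)))
      (fun ω' => 1 / (2 * γ ω')) P P' := by
  obtain ⟨mL, hlaw⟩ := map_iInf_exp_neg_integral hB hb
  set L : Ω → ℝ := fun ω => ⨅ N : ℕ, Real.exp (-∫ s in (0 : ℝ)..N,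
    Real.exp (-2 * (B s.toNNReal ω + b * s))) with hL
  have mg : Measurable fun x : ℝ => Real.exp (-(1 / (2 * x))) := by fun_prop
  -- Positivity is read off from the law of exp(-1/(2γ)); it excludes an infinite integral.
  have hpos : ∀ᵐ ω ∂P, 0 < L ω := by
    rw [← ae_map_iff (p := fun y => 0 < y) mL measurableSet_Ioi, hlaw,
      ae_map_iff mg.aemeasurable measurableSet_Ioi]
    exact ae_of_all _ fun x => Real.exp_pos _
  have hfin : ∀ᵐ ω ∂P, IntegrableOn
      (fun s : ℝ => Real.exp (-2 * (B s.toNNReal ω + b * s))) (Set.Ioi 0) ∧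
      ∫ s in Set.Ioi (0 : ℝ), Real.exp (-2 * (B s.toNNReal ω + b * s)) = -Real.log (L ω) := by
    filter_upwards [hB.cont, hpos] with ω hω hLω
    exact integrableOn_exp_drift_of_iInf_pos hω hLω
  have hae : (fun ω => ∫ s in Set.Ioi (0 : ℝ), Real.exp (-2 * (B s.toNNReal ω + b * s)))
      =ᵐ[P] fun ω => -Real.log (L ω) := hfin.mono fun _ h => h.2
  have mlog : Measurable fun y : ℝ => -Real.log y := by fun_prop
  have mγ := hγ.aemeasurable
  refine ⟨hfin.mono fun _ h => h.1, (mlog.comp_aemeasurable mL).congr hae.symm, ?_, ?_⟩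
  · fun_prop
  have e1 : P.map (fun ω => -Real.log (L ω)) = (P.map L).map fun y => -Real.log y :=
    (AEMeasurable.map_map_of_aemeasurable mlog.aemeasurable mL).symm
  have e2 : P'.map (fun ω' => 1 / (2 * γ ω')) = (P'.map γ).map fun x => 1 / (2 * x) :=
    (AEMeasurable.map_map_of_aemeasurable (g := fun x : ℝ => 1 / (2 * x)) (by fun_prop) mγ).symm
  rw [Measure.map_congr hae, e1, hlaw, Measure.map_map mlog mg, e2, hγ.map_eq]
  congr 1
  funext x
  simp
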